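/- Let $R$ be a commutative Noetherian ring, and let $p\ge 1$, $q\ge 3$ be integers. For an ideal $K\subseteq R$ put $\operatorname{grade} K=\inf\{i : \operatorname{Ext}^i_R(R/K,R)\ne 0\}$, so that the unit ideal has grade $\infty$. For a linear map $\varphi$ of finite free modules, $I_k(\varphi)$ is the ideal generated by the $k\times k$ minors of $\varphi$. A complex $0\to F_n\to\cdots\to F_0$ is called acyclic if it is exact except possibly at $F_0$. Let $$\mathbb A\colon\ 0\to A_3\xrightarrow{d_3}A_2\xrightarrow{d_2}A_1\xrightarrow{d_1}A_0=R$$ be an acyclic complex of free $R$-modules with $\operatorname{rank}A_1=p+2$, $\operatorname{rank}A_2=p+q$, $\operatorname{rank}A_3=q-1$ (so $\mathbb A$ resolves $R/I$ with $I=\operatorname{im} d_1$), and suppose that the dual complex $0\to A_0^*\to A_1^*\to A_2^*\to A_3^*$ is acyclic too. Fix a graded-commutative differential graded algebra structure on $\mathbb A$ with unit $1\in A_0=R$, and a decomposition $A_3=C\oplus L$ with $C\cong R^{q-2}$ and $L\cong R$; let $\eta\colon A_3\to L$ be the projection along $C$. For finite free $M$ identify $M^*\otimes L$ with $\operatorname{Hom}(M,L)$,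 and consider $$\mathbb B\colon\ 0\to C\xrightarrow{\delta_4}A_2\xrightarrow{\delta_3}(A_1^*\otimes L)\oplus A_1\xrightarrow{\delta_2}A_2^*\otimes L\xrightarrow{\delta_1}C^*\otimes L,$$ where $\delta_4=d_3|_C$, where $\delta_3(f)=(\eta((-)\cdot f),\,d_2(f))$ for $f\in A_2$, where $\delta_2=\delta_3^*$, that is, $\delta_2(\varphi,e)(f)=\varphi(d_2f)+\eta(e\cdot f)$, and where $\delta_1=\delta_4^*$, that is, $\delta_1(\psi)=\psi\circ\delta_4$. Then $\mathbb B$ is a complex, and it is self-dual up to the twist by $L$: the evaluation maps $C\to\operatorname{Hom}(\operatorname{Hom}(C,L),L)$ and $A_2\to\operatorname{Hom}(\operatorname{Hom}(A_2,L),L)$, the map $(A_1^*\otimes L)\oplus A_1\to\operatorname{Hom}((A_1^*\otimes L)\oplus A_1,L)$ given by the pairing $\langle(\varphi,e),(\psi,e')\rangle=\psi(e)+\varphi(e')$, and the identity maps of $A_2^*\otimes L$ and $C^*\otimes L$ form an isomorphism of complexes $\mathbb B\to\operatorname{Hom}(\mathbb B,L)$. Moreover, let $J=I_{q-2}(\delta_4)$.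 If $\operatorname{grade}J\ge 4$, then $\mathbb B$ is acyclic, and either $\operatorname{grade}J=4$ or $J=(1)$. -/

import Mathlib

universe u v

/-- `M` is a free `R`-module of rank `n`, i.e. `M ≅ R ^ n`. -/
def IsFreeOfRank (R : Type*) [CommRing R] (M : Type*) [AddCommGroup M] [Module R M]
    (n : ℕ) : Prop :=
  Nonempty (Module.Basis (Fin n) R M)

/-- The grade of a module: `grade M = inf {i | Ext^i(M, R) ≠ 0}`, with `inf ∅ = ∞`. -/
noncomputable def moduleGrade (R : Type u) [CommRing R] (M : Type u) [AddCommGroup M]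
    [Module R M] : ℕ∞ :=
  sInf {n : ℕ∞ | ∃ i : ℕ, n = (i : ℕ∞) ∧
    Nontrivial (CategoryTheory.Abelian.Ext (ModuleCat.of R M) (ModuleCat.of R R) i)}

/-- The grade of an ideal `I` is the grade of the module `R ⧸ I`. -/
noncomputable def idealGrade {R : Type u} [CommRing R] (I : Ideal R) : ℕ∞ :=
  moduleGrade R (R ⧸ I)

section Minors

variable {R : Type*} [CommRing R] {M N : Type*} [AddCommGroup M] [Module R M]
  [AddCommGroup N] [Module R N]

/-- The ideal `I_k(φ)` of `k × k` minors of a linear map `φ : M → N` of free modules, written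
without bases: it is generated by the determinants `det (ψ_i (φ (x_j)))` with `x_j ∈ M` and
`ψ_i ∈ N^*`, i.e. it is the image of `⋀^k M ⊗ ⋀^k N^* → R`. See `minorsIdeal_eq_span_minors` for
the description by a matrix of `φ`. -/
def minorsIdeal (k : ℕ) (φ : M →ₗ[R] N) : Ideal R :=
  Ideal.span {a : R | ∃ (x : Fin k → M) (ψ : Fin k → Module.Dual R N),
    a = (Matrix.of fun i j => ψ i (φ (x j))).det}

theorem det_mul_mem {m : Type*} [Fintype m] {k : ℕ} (I : Ideal R)
    (P : Matrix (Fin k) m R) (X : Matrix m (Fin k) R)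
    (h : ∀ r : Fin k → m, (X.submatrix r id).det ∈ I) : (P * X).det ∈ I := by
  have : (P * X).det = ∑ r : Fin k → m, (∏ i, P i (r i)) * (X.submatrix r id).det := by
    have h1 : (P * X) = fun i => ∑ a, P i a • X a := by
      ext i j
      simp [Matrix.mul_apply]
    rw [h1]
    change Matrix.detRowAlternating (fun i => ∑ a, P i a • X a) = _
    classical
    rw [← AlternatingMap.coe_multilinearMap, MultilinearMap.map_sum]
    refine Finset.sum_congr rfl fun r _ => ?_
    rw [MultilinearMap.map_smul_univ]
    rfl
  rw [this]
  exact Ideal.sum_mem _ fun r _ => Ideal.mul_mem_left _ _ (h r)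

/-- In terms of bases, `I_k(φ)` is the ideal of `k × k` minors of the matrix of `φ`. -/
theorem minorsIdeal_eq_span_minors {m n : Type*} [Fintype m] [Fintype n] [DecidableEq n]
    (b : Module.Basis n R M) (c : Module.Basis m R N) (k : ℕ) (φ : M →ₗ[R] N) :
    minorsIdeal k φ = Ideal.span {a : R | ∃ (r : Fin k → m) (s : Fin k → n),
      a = ((LinearMap.toMatrix b c φ).submatrix r s).det} := by
  apply le_antisymm
  · refine Ideal.span_le.2 ?_
    rintro a ⟨x, ψ, rfl⟩
    have key : (Matrix.of fun i j => ψ i (φ (x j))) =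
        (Matrix.of fun i a => ψ i (c a)) * (LinearMap.toMatrix b c φ *
          (Matrix.of fun a j => b.repr (x j) a)) := by
      ext i j
      have h1 : φ (x j) = ∑ a, (LinearMap.toMatrix b c φ *
          (Matrix.of fun a j => b.repr (x j) a)) a j • c a := by
        conv_lhs => rw [← c.sum_repr (φ (x j))]
        refine Finset.sum_congr rfl fun a _ => ?_
        congr 1
        rw [← LinearMap.toMatrix_mulVec_repr b c φ (x j)]
        rfl
      simp only [Matrix.of_apply]
      rw [h1, map_sum, Matrix.mul_apply]
      refine Finset.sum_congr rfl fun a _ => ?_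
      rw [map_smul, smul_eq_mul, mul_comm]
      rfl
    rw [SetLike.mem_coe, key]
    refine det_mul_mem _ _ _ fun r => ?_
    rw [← Matrix.det_transpose, Matrix.transpose_submatrix, Matrix.transpose_mul]
    have : ((Matrix.of fun a j => b.repr (x j) a).transpose *
        (LinearMap.toMatrix b c φ).transpose).submatrix id r =
        (Matrix.of fun a j => b.repr (x j) a).transpose *
        ((LinearMap.toMatrix b c φ).transpose.submatrix id r) := rfl
    rw [this]
    refine det_mul_mem _ _ _ fun s => Ideal.subset_span ⟨r, s, ?_⟩
    rw [← Matrix.det_transpose]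
    rfl
  · refine Ideal.span_le.2 ?_
    rintro a ⟨r, s, rfl⟩
    refine Ideal.subset_span ⟨fun j => b (s j), fun i => c.coord (r i), ?_⟩
    congr 1
    ext i j
    simp [LinearMap.toMatrix_apply]

end Minors

section Complexes

variable {R : Type*} [CommRing R]
  {F₀ F₁ F₂ F₃ F₄ : Type*}
  [AddCommGroup F₀] [Module R F₀] [AddCommGroup F₁] [Module R F₁]
  [AddCommGroup F₂] [Module R F₂] [AddCommGroup F₃] [Module R F₃]
  [AddCommGroup F₄] [Module R F₄]

/-- `0 → F₃ → F₂ → F₁ → F₀` is an acyclic complex, i.e. exact except possibly at `F₀`. -/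
def IsAcyclicThree (d₃ : F₃ →ₗ[R] F₂) (d₂ : F₂ →ₗ[R] F₁) (d₁ : F₁ →ₗ[R] F₀) : Prop :=
  Function.Injective d₃ ∧ Function.Exact d₃ d₂ ∧ Function.Exact d₂ d₁

/-- `0 → F₄ → F₃ → F₂ → F₁ → F₀` is a complex. -/
def IsComplexFour (δ₄ : F₄ →ₗ[R] F₃) (δ₃ : F₃ →ₗ[R] F₂) (δ₂ : F₂ →ₗ[R] F₁)
    (δ₁ : F₁ →ₗ[R] F₀) : Prop :=
  δ₃ ∘ₗ δ₄ = 0 ∧ δ₂ ∘ₗ δ₃ = 0 ∧ δ₁ ∘ₗ δ₂ = 0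

/-- `0 → F₄ → F₃ → F₂ → F₁ → F₀` is an acyclic complex, i.e. exact except possibly at `F₀`. -/
def IsAcyclicFour (δ₄ : F₄ →ₗ[R] F₃) (δ₃ : F₃ →ₗ[R] F₂) (δ₂ : F₂ →ₗ[R] F₁)
    (δ₁ : F₁ →ₗ[R] F₀) : Prop :=
  Function.Injective δ₄ ∧ Function.Exact δ₄ δ₃ ∧ Function.Exact δ₃ δ₂ ∧ Function.Exact δ₂ δ₁

end Complexes

section DGAlgebra

variable {R : Type*} [CommRing R] {A₁ A₂ A₃ : Type*}
  [AddCommGroup A₁] [Module R A₁] [AddCommGroup A₂] [Module R A₂]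
  [AddCommGroup A₃] [Module R A₃]

/-- A graded-commutative DG-algebra structure, with unit `1 ∈ A₀ = R`, on a complex
`0 → A₃ → A₂ → A₁ → R`. Products with `A₀` are scalar multiplications, `f · e = e · f` for
`e ∈ A₁`, `f ∈ A₂`, and all products of total degree `≥ 4` vanish. The remaining laws
(the Leibniz rule in total degree 4 and associativity) are automatic when `d₃` is injective:
see the lemmas below. -/
structure DGAStructure (d₃ : A₃ →ₗ[R] A₂) (d₂ : A₂ →ₗ[R] A₁) (d₁ : A₁ →ₗ[R] R) where
  /-- the product `A₁ ⊗ A₁ → A₂` -/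
  mul₁₁ : A₁ →ₗ[R] A₁ →ₗ[R] A₂
  /-- the product `A₁ ⊗ A₂ → A₃` -/
  mul₁₂ : A₁ →ₗ[R] A₂ →ₗ[R] A₃
  comm₁₁ : ∀ e e' : A₁, mul₁₁ e e' = -mul₁₁ e' e
  leibniz₁₁ : ∀ e e' : A₁, d₂ (mul₁₁ e e') = d₁ e • e' - d₁ e' • e
  leibniz₁₂ : ∀ (e : A₁) (f : A₂), d₃ (mul₁₂ e f) = d₁ e • f - mul₁₁ e (d₂ f)

namespace DGAStructure

variable {d₃ : A₃ →ₗ[R] A₂} {d₂ : A₂ →ₗ[R] A₁} {d₁ : A₁ →ₗ[R] R}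

theorem leibniz₁₃ (μ : DGAStructure d₃ d₂ d₁) (h₃ : Function.Injective d₃)
    (h : ∀ g, d₂ (d₃ g) = 0) (e : A₁) (g : A₃) : d₁ e • g - μ.mul₁₂ e (d₃ g) = 0 := by
  apply h₃
  simp [μ.leibniz₁₂, h]

theorem leibniz₂₂ (μ : DGAStructure d₃ d₂ d₁) (h₃ : Function.Injective d₃)
    (h : ∀ f, d₁ (d₂ f) = 0) (f f' : A₂) :
    μ.mul₁₂ (d₂ f) f' + μ.mul₁₂ (d₂ f') f = 0 := by
  apply h₃
  rw [map_add, μ.leibniz₁₂, μ.leibniz₁₂, μ.comm₁₁ (d₂ f) (d₂ f')]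
  simp [h]

theorem assoc (μ : DGAStructure d₃ d₂ d₁) (h₃ : Function.Injective d₃) (e e' e'' : A₁) :
    μ.mul₁₂ e (μ.mul₁₁ e' e'') = μ.mul₁₂ e'' (μ.mul₁₁ e e') := by
  apply h₃
  simp only [μ.leibniz₁₂, μ.leibniz₁₁, map_sub, map_smul]
  rw [μ.comm₁₁ e'' e', μ.comm₁₁ e'' e]
  module

end DGAStructure

end DGAlgebra

section TwistedDuality

variable {R : Type*} [CommRing R]

/-- The dual of `φ : M → N` twisted by `L`, i.e. the map
`N^* ⊗ L = Hom(N, L) → Hom(M, L) = M^* ⊗ L`, `ψ ↦ ψ ∘ φ`. -/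
def twistedDual {M N : Type*} [AddCommGroup M] [Module R M] [AddCommGroup N] [Module R N]
    (L : Type*) [AddCommGroup L] [Module R L] (φ : M →ₗ[R] N) :
    (N →ₗ[R] L) →ₗ[R] (M →ₗ[R] L) :=
  LinearMap.lcomp R L φ

/-- The evident symmetric `L`-valued pairing on `Hom(H, L) ⊕ H`,
`⟨(φ, e), (ψ, e')⟩ = ψ e + φ e'`, viewed as a map `Hom(H, L) ⊕ H → Hom(Hom(H, L) ⊕ H, L)`. -/
def hyperbolicPairing (R : Type*) [CommRing R] (H L : Type*) [AddCommGroup H] [Module R H]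
    [AddCommGroup L] [Module R L] :
    ((H →ₗ[R] L) × H) →ₗ[R] (((H →ₗ[R] L) × H) →ₗ[R] L) :=
  LinearMap.mk₂ R (fun x y => y.1 x.2 + x.1 y.2)
    (fun x x' y => by simp; abel) (fun a x y => by simp)
    (fun x y y' => by simp; abel) (fun a x y => by simp)

/-- The complex `F₄ → F₃ → F₂ → Hom(F₃, L) → Hom(F₄, L)` is self-dual up to the twist by `L`,
through `θ : F₂ → Hom(F₂, L)`: the evaluation maps `F₄ → Hom(Hom(F₄, L), L)` and
`F₃ → Hom(Hom(F₃, L), L)`, the map `θ` and two identity maps are the components of an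
isomorphism from the complex to its `L`-twisted dual. -/
def IsSelfDualFour {F₄ F₃ F₂ L : Type*} [AddCommGroup F₄] [Module R F₄]
    [AddCommGroup F₃] [Module R F₃] [AddCommGroup F₂] [Module R F₂] [AddCommGroup L] [Module R L]
    (θ : F₂ →ₗ[R] (F₂ →ₗ[R] L))
    (δ₄ : F₄ →ₗ[R] F₃) (δ₃ : F₃ →ₗ[R] F₂) (δ₂ : F₂ →ₗ[R] (F₃ →ₗ[R] L))
    (δ₁ : (F₃ →ₗ[R] L) →ₗ[R] (F₄ →ₗ[R] L)) : Prop :=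
  Function.Bijective (LinearMap.applyₗ : F₄ →ₗ[R] (F₄ →ₗ[R] L) →ₗ[R] L) ∧
  Function.Bijective (LinearMap.applyₗ : F₃ →ₗ[R] (F₃ →ₗ[R] L) →ₗ[R] L) ∧
  Function.Bijective θ ∧
  twistedDual L δ₁ ∘ₗ (LinearMap.applyₗ : F₄ →ₗ[R] (F₄ →ₗ[R] L) →ₗ[R] L) =
    (LinearMap.applyₗ : F₃ →ₗ[R] (F₃ →ₗ[R] L) →ₗ[R] L) ∘ₗ δ₄ ∧
  twistedDual L δ₂ ∘ₗ (LinearMap.applyₗ : F₃ →ₗ[R] (F₃ →ₗ[R] L) →ₗ[R] L) = θ ∘ₗ δ₃ ∧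
  twistedDual L δ₃ ∘ₗ θ = δ₂ ∧
  twistedDual L δ₄ = δ₁

end TwistedDuality

section Construction

variable {R : Type*} [CommRing R] {A₁ A₂ A₃ : Type*}
  [AddCommGroup A₁] [Module R A₁] [AddCommGroup A₂] [Module R A₂]
  [AddCommGroup A₃] [Module R A₃]
  {d₃ : A₃ →ₗ[R] A₂} {d₂ : A₂ →ₗ[R] A₁} {d₁ : A₁ →ₗ[R] R}

/-- `δ₄ : C → A₂`, the restriction of `d₃` to `C ⊆ A₃`. -/
def deltaFour (d₃ : A₃ →ₗ[R] A₂) (C : Submodule R A₃) : C →ₗ[R] A₂ :=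
  d₃ ∘ₗ C.subtype

/-- The projection `η : A₃ = C ⊕ L → L`. -/
noncomputable def etaProj {C L : Submodule R A₃} (hCL : IsCompl C L) : A₃ →ₗ[R] L :=
  L.projectionOnto C hCL.symm

/-- `δ₃ : A₂ → Hom(A₁, L) ⊕ A₁`, `δ₃ f = (η((-) · f), d₂ f)`. -/
noncomputable def deltaThree (μ : DGAStructure d₃ d₂ d₁) {C L : Submodule R A₃}
    (hCL : IsCompl C L) : A₂ →ₗ[R] (A₁ →ₗ[R] L) × A₁ :=
  LinearMap.prod (μ.mul₁₂.compr₂ (etaProj hCL)).flip d₂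

/-- `δ₂ = δ₃^* : Hom(A₁, L) ⊕ A₁ → Hom(A₂, L)`, the `L`-twisted dual of `δ₃`, where
`Hom(A₁, L) ⊕ A₁` is identified with its own `L`-twisted dual by the evident pairing. -/
noncomputable def deltaTwo (μ : DGAStructure d₃ d₂ d₁) {C L : Submodule R A₃}
    (hCL : IsCompl C L) : ((A₁ →ₗ[R] L) × A₁) →ₗ[R] (A₂ →ₗ[R] L) :=
  twistedDual L (deltaThree μ hCL) ∘ₗ hyperbolicPairing R A₁ L

/-- `δ₁ = δ₄^* : Hom(A₂, L) → Hom(C, L)`, the `L`-twisted dual of `δ₄`. -/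
noncomputable def deltaOne (d₃ : A₃ →ₗ[R] A₂) (C L : Submodule R A₃) :
    (A₂ →ₗ[R] L) →ₗ[R] (C →ₗ[R] L) :=
  twistedDual L (deltaFour d₃ C)

end Construction

/-!
That `𝔹` is a self-dual complex is the Leibniz rule together with graded commutativity, after
applying `η`. Exactness at `A₂` and at `Hom(A₁, L) ⊕ A₁` follows by lifting through the exact
sequences `𝔸` and `𝔸^* ⊗ L`.

At `Hom(A₂, L)`, let `ψ` vanish on `d₃ C`. Then `ψ ∘ d₃ = x • η` for a scalar `x`, and if
`x = d₁ e`, then `ψ` differs from `η(e · -)` by some `φ ∘ d₂`, so `ψ` is in the image of `δ₂`. That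
`x ∈ I = im d₁` is seen as follows. For a maximal minor `a` of `δ₄`, multiplication by `a` on `C`
factors through `δ₄` by Cramer's rule; combined with `ψ` this gives a map `s : A₂ → A₃` with
`s ∘ d₃ = a x`, and acyclicity of `𝔸^*` extends `s` to a null-homotopy of `a x` on all of `𝔸`, so
`a x ∈ I`. Hence `J x ⊆ I`, and since `grade J` exceeds the length of the resolution `𝔸` of
`R ⧸ I`, no nonzero element of `R ⧸ I` is killed by `J`.

The same torsion argument for the resolution `𝔹` of `coker δ₁`, a module killed by `J`, shows that
`δ₁` is surjective if `grade J ≥ 5`. Then `δ₄` is a split injection and `J = (1)`.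
-/

theorem IsFreeOfRank.finite_and_projective {R M : Type*} [CommRing R] [AddCommGroup M]
    [Module R M] {n : ℕ} (h : IsFreeOfRank R M n) : Module.Finite R M ∧ Module.Projective R M :=
  let ⟨b⟩ := h
  ⟨.of_basis b, .of_basis b⟩

theorem IsFreeOfRank.invertible {R L : Type*} [CommRing R] [AddCommGroup L] [Module R L]
    (h : IsFreeOfRank R L 1) : Module.Invertible R L :=
  let ⟨b⟩ := h
  .congr (b.equivFun.trans (LinearEquiv.funUnique (Fin 1) R R)).symm

section Reflexivity

variable {R : Type*} [CommRing R] {M L : Type*} [AddCommGroup M] [Module R M]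
  [AddCommGroup L] [Module R L]

theorem injective_applyₗ [Module.Projective R M] [FaithfulSMul R L] :
    Function.Injective (LinearMap.applyₗ : M →ₗ[R] (M →ₗ[R] L) →ₗ[R] L) := by
  refine (injective_iff_map_eq_zero _).2 fun x hx => ?_
  refine (Module.forall_dual_apply_eq_zero_iff R x).1 fun f => ?_
  refine FaithfulSMul.eq_of_smul_eq_smul (α := L) fun l => ?_
  rw [zero_smul]
  exact LinearMap.congr_fun hx (f.smulRight l)

theorem surjective_applyₗ [Module.Finite R M] [Module.Projective R M] [Module.Invertible R L] :
    Function.Surjective (LinearMap.applyₗ : M →ₗ[R] (M →ₗ[R] L) →ₗ[R] L) := by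
  intro Φ
  obtain ⟨n, f, g, -, -, hfg⟩ := Module.Finite.exists_comp_eq_id_of_projective R M
  -- Testing `Φ` on the rank-one maps `g_j ⊗ l` gives an endomorphism of `L`, hence a scalar `a j`.
  choose a ha using fun j => (Module.Invertible.toModuleEnd_bijective R L).2
    (Φ ∘ₗ LinearMap.smulRightₗ (LinearMap.proj j ∘ₗ g))
  have hΦ (j : Fin n) (l : L) : Φ ((LinearMap.proj j ∘ₗ g).smulRight l) = a j • l :=
    (LinearMap.congr_fun (ha j) l).symm
  refine ⟨f a, LinearMap.ext fun φ => ?_⟩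
  obtain ⟨l, hl⟩ : ∃ l : Fin n → L, ∀ v, φ (f v) = ∑ j, v j • l j :=
    ⟨_, LinearMap.pi_apply_eq_sum_univ (φ ∘ₗ f)⟩
  have hφ : φ = ∑ j, (LinearMap.proj j ∘ₗ g).smulRight (l j) := by
    ext x
    have hx : f (g x) = x := LinearMap.congr_fun hfg x
    simpa [hx] using hl (g x)
  calc φ (f a) = ∑ j, a j • l j := hl a
    _ = Φ (∑ j, (LinearMap.proj j ∘ₗ g).smulRight (l j)) := by simp only [map_sum, hΦ]
    _ = Φ φ := by rw [← hφ]

theorem bijective_applyₗ [Module.Finite R M] [Module.Projective R M] [Module.Invertible R L] :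
    Function.Bijective (LinearMap.applyₗ : M →ₗ[R] (M →ₗ[R] L) →ₗ[R] L) :=
  ⟨injective_applyₗ, surjective_applyₗ⟩

theorem bijective_hyperbolicPairing
    (h : Function.Bijective (LinearMap.applyₗ : M →ₗ[R] (M →ₗ[R] L) →ₗ[R] L)) :
    Function.Bijective (hyperbolicPairing R M L) := by
  have hθ : ⇑(hyperbolicPairing R M L) =
      LinearMap.coprodEquiv R ∘ Prod.map LinearMap.applyₗ id ∘ Prod.swap := rfl
  rw [hθ]
  exact (LinearMap.coprodEquiv R).bijective.comp
    ((h.prodMap Function.bijective_id).comp Prod.swap_bijective)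

end Reflexivity

section TwistedDual

variable {R : Type*} [CommRing R] {M N P : Type*} [AddCommGroup M] [Module R M]
  [AddCommGroup N] [Module R N] [AddCommGroup P] [Module R P]
  {Q : Type*} [AddCommGroup Q] [Module R Q]

theorem injective_twistedDual [Module.Projective R Q] {f : M →ₗ[R] N}
    (h : Function.Injective f.dualMap) : Function.Injective (twistedDual Q f) := by
  refine (injective_iff_map_eq_zero _).2 fun ψ hψ => LinearMap.ext fun y => ?_
  refine (Module.forall_dual_apply_eq_zero_iff R _).1 fun t => ?_
  have ht : t ∘ₗ ψ = 0 := (injective_iff_map_eq_zero _).1 h _ <| LinearMap.ext fun x =>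
    (congrArg t (LinearMap.congr_fun hψ x)).trans t.map_zero
  exact LinearMap.congr_fun ht y

theorem exact_twistedDual [Module.Finite R Q] [Module.Projective R Q]
    {f : M →ₗ[R] N} {g : N →ₗ[R] P} (h : Function.Exact g.dualMap f.dualMap) :
    Function.Exact (twistedDual Q g) (twistedDual Q f) :=
  .of_ladder_linearEquiv_of_exact
    (e₁ := .ofBijective _ dualTensorHom_bijective_of_finite_projective_right)
    (e₂ := .ofBijective _ dualTensorHom_bijective_of_finite_projective_right)
    (e₃ := .ofBijective _ dualTensorHom_bijective_of_finite_projective_right)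
    (dualTensorHom_comp_rTensor_dualMap g).symm (dualTensorHom_comp_rTensor_dualMap f).symm
    (Module.Flat.rTensor_exact Q h)

theorem surjective_dualMap_of_surjective_twistedDual [Module.Invertible R Q] {f : M →ₗ[R] N}
    (h : Function.Surjective (twistedDual Q f)) : Function.Surjective f.dualMap := by
  have hMQ : Function.Bijective (dualTensorHom R M Q) :=
    dualTensorHom_bijective_of_finite_projective_right
  have hNQ : Function.Bijective (dualTensorHom R N Q) :=
    dualTensorHom_bijective_of_finite_projective_right
  refine (Module.Invertible.rTensor_surjective_iff Q).1 (.of_comp_left ?_ hMQ.1)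
  rw [← LinearMap.coe_comp, dualTensorHom_comp_rTensor_dualMap]
  exact h.comp hNQ.2

theorem finite_linearMap [Module.Finite R M] [Module.Projective R M] [Module.Finite R Q] :
    Module.Finite R (M →ₗ[R] Q) :=
  .of_surjective (dualTensorHom R M Q) dualTensorHom_bijective.2

theorem projective_linearMap [Module.Finite R M] [Module.Projective R M] [Module.Projective R Q] :
    Module.Projective R (M →ₗ[R] Q) :=
  .of_equiv (.ofBijective (dualTensorHom R M Q) dualTensorHom_bijective)

end TwistedDual

section Minors

open Matrix

variable {R : Type*} [CommRing R] {M N : Type*} [AddCommGroup M] [Module R M]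
  [AddCommGroup N] [Module R N] {n : ℕ}

theorem of_apply_apply_eq_mul_toMatrix (b : Module.Basis (Fin n) R M) (φ : M →ₗ[R] N)
    (x : Fin n → M) (ψ : Fin n → Module.Dual R N) :
    (Matrix.of fun i j => ψ i (φ (x j))) =
      (Matrix.of fun i j => ψ i (φ (b j))) * b.toMatrix x := by
  ext i j
  conv_lhs => rw [Matrix.of_apply, ← b.sum_toMatrix_smul_self x j]
  simp only [map_sum, map_smul, smul_eq_mul, mul_comm, Matrix.mul_apply, Matrix.of_apply]

theorem exists_comp_eq_det_smul_id (b : Module.Basis (Fin n) R M) (φ : M →ₗ[R] N)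
    (ψ : Fin n → Module.Dual R N) :
    ∃ σ : N →ₗ[R] M, σ ∘ₗ φ = (Matrix.of fun i j => ψ i (φ (b j))).det • LinearMap.id := by
  set A := Matrix.of fun i j => ψ i (φ (b j)) with hA
  refine ⟨b.equivFun.symm ∘ₗ A.adjugate.mulVecLin ∘ₗ LinearMap.pi ψ, b.ext fun j => ?_⟩
  have hcol : LinearMap.pi ψ (φ (b j)) = A *ᵥ Pi.single j 1 := by
    ext i
    simp [hA]
  simp only [LinearMap.comp_apply, hcol, mulVecLin_apply, mulVec_mulVec, adjugate_mul,
    smul_mulVec, one_mulVec, map_smul, LinearEquiv.coe_coe, LinearMap.smul_apply,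
    LinearMap.id_apply]
  simp

theorem exists_comp_eq_smul_id_of_mem_minorsIdeal (b : Module.Basis (Fin n) R M)
    {φ : M →ₗ[R] N} {a : R} (ha : a ∈ minorsIdeal n φ) :
    ∃ σ : N →ₗ[R] M, σ ∘ₗ φ = a • LinearMap.id := by
  suffices h : minorsIdeal n φ ≤
      (LinearMap.range (twistedDual M φ)).comap (LinearMap.toSpanSingleton R _ LinearMap.id) from
    h ha
  refine Ideal.span_le.2 ?_
  rintro _ ⟨x, ψ, rfl⟩
  obtain ⟨σ, hσ⟩ := exists_comp_eq_det_smul_id b φ ψ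
  rw [of_apply_apply_eq_mul_toMatrix b φ x ψ, Matrix.det_mul, mul_comm]
  refine ⟨(b.toMatrix x).det • σ, ?_⟩
  rw [LinearMap.toSpanSingleton_apply, mul_smul, map_smul]
  exact congrArg _ hσ

theorem smul_mem_range_twistedDual {L : Type*} [AddCommGroup L] [Module R L]
    (b : Module.Basis (Fin n) R M) {φ : M →ₗ[R] N} {a : R} (ha : a ∈ minorsIdeal n φ)
    (χ : M →ₗ[R] L) :
    a • χ ∈ LinearMap.range (twistedDual L φ) := by
  obtain ⟨σ, hσ⟩ := exists_comp_eq_smul_id_of_mem_minorsIdeal b ha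
  refine ⟨χ ∘ₗ σ, ?_⟩
  change χ ∘ₗ (σ ∘ₗ φ) = a • χ
  rw [hσ, LinearMap.comp_smul, LinearMap.comp_id]

theorem minorsIdeal_eq_top_of_surjective_dualMap (b : Module.Basis (Fin n) R M)
    {φ : M →ₗ[R] N} (h : Function.Surjective φ.dualMap) :
    minorsIdeal n φ = ⊤ := by
  choose t ht using fun i => h (b.coord i)
  have hb : (Matrix.of fun i j => t i (φ (b j))) = 1 := by
    ext i j
    have hij : t i (φ (b j)) = b.coord i (b j) := LinearMap.congr_fun (ht i) (b j)
    simp [hij, Matrix.one_apply, Finsupp.single_apply, eq_comm]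
  exact (Ideal.eq_top_iff_one _).2 <| Ideal.subset_span ⟨b, t, by rw [hb, Matrix.det_one]⟩

end Minors

section ExtVanishing

open CategoryTheory Abelian

variable {R : Type u} [CommRing R]

theorem subsingleton_ext_of_shortExact {X : ModuleCat.{u} R} {S : ShortComplex (ModuleCat.{u} R)}
    (hS : S.ShortExact) {i : ℕ} (h₁ : Subsingleton (Ext X S.X₁ (i + 1)))
    (h₂ : Subsingleton (Ext X S.X₂ i)) : Subsingleton (Ext X S.X₃ i) := by
  refine subsingleton_of_forall_eq 0 fun x => ?_
  obtain ⟨y, rfl⟩ := Ext.covariant_sequence_exact₃ X hS x rfl (Subsingleton.elim _ _)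
  rw [Subsingleton.elim y 0, Ext.zero_comp]

theorem subsingleton_ext_of_finite_projective {X P : ModuleCat.{u} R} [Module.Finite R P]
    [Module.Projective R P] {i : ℕ} (h : Subsingleton (Ext X (ModuleCat.of R R) i)) :
    Subsingleton (Ext X P i) := by
  obtain ⟨n, f, g, -, -, hfg⟩ := Module.Finite.exists_comp_eq_id_of_projective R P
  have hid : 𝟙 P = ∑ j : Fin n, ModuleCat.ofHom (LinearMap.proj j ∘ₗ g) ≫
      ModuleCat.ofHom (f ∘ₗ LinearMap.single R (fun _ => R) j) := by
    ext x
    have hx : f (g x) = x := LinearMap.congr_fun hfg x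
    simp [ModuleCat.hom_sum, ← map_sum, Finset.univ_sum_single, hx]
  refine subsingleton_of_forall_eq 0 fun x => ?_
  rw [← Ext.comp_mk₀_id x, hid, Ext.mk₀_sum, Ext.comp_sum]
  refine Finset.sum_eq_zero fun j _ => ?_
  rw [← Ext.mk₀_comp_mk₀, ← Ext.comp_assoc_of_second_deg_zero,
    Subsingleton.elim (x.comp (Ext.mk₀ (ModuleCat.ofHom (LinearMap.proj j ∘ₗ g))) (add_zero i)) 0,
    Ext.zero_comp]

theorem subsingleton_ext_of_lt_idealGrade {J : Ideal R} {i : ℕ} (h : (i : ℕ∞) < idealGrade J) :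
    Subsingleton (Ext (ModuleCat.of R (R ⧸ J)) (ModuleCat.of R R) i) := by
  by_contra hi
  exact (notMem_of_lt_csInf' h) ⟨i, rfl, not_subsingleton_iff_nontrivial.1 hi⟩

/-- The ideal `J` has grade at least `k` on `M`, that is, `Ext^i(R ⧸ J, M) = 0` for all `i < k`.
Since `M` may live in any universe, the condition is imposed on a module `M' ≅ M` in the universe
of `R`, whose existence is part of the definition. -/
def ExtVanishesBelow (J : Ideal R) (k : ℕ) (M : Type*) [AddCommGroup M] [Module R M] : Prop :=
  ∃ M' : ModuleCat.{u} R, Nonempty (M ≃ₗ[R] M') ∧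
    ∀ i < k, Subsingleton (Ext (ModuleCat.of R (R ⧸ J)) M' i)

variable {J : Ideal R} {k : ℕ} {M N P : Type*} [AddCommGroup M] [Module R M]
  [AddCommGroup N] [Module R N] [AddCommGroup P] [Module R P]

theorem extVanishesBelow_of_le_idealGrade [Module.Finite R M] [Module.Projective R M]
    (h : (k : ℕ∞) ≤ idealGrade J) : ExtVanishesBelow J k M := by
  have := Module.Finite.small.{u} R M
  let e : Shrink.{u} M ≃ₗ[R] M := Shrink.linearEquiv R M
  have := Module.Finite.equiv e.symm
  have := Module.Projective.of_equiv e.symm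
  exact ⟨ModuleCat.of R (Shrink.{u} M), ⟨e.symm⟩, fun i hi =>
    subsingleton_ext_of_finite_projective <|
      subsingleton_ext_of_lt_idealGrade ((Nat.cast_lt.2 hi).trans_le h)⟩

namespace ExtVanishesBelow

theorem of_linearEquiv (h : ExtVanishesBelow J k M) (e : M ≃ₗ[R] N) : ExtVanishesBelow J k N :=
  let ⟨M', ⟨e'⟩, hM'⟩ := h
  ⟨M', ⟨e.symm.trans e'⟩, hM'⟩

theorem quotient {K : Submodule R N} (hK : ExtVanishesBelow J (k + 1) K)
    (hN : ExtVanishesBelow J k N) : ExtVanishesBelow J k (N ⧸ K) := by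
  obtain ⟨K', ⟨eK⟩, hK⟩ := hK
  obtain ⟨N', ⟨eN⟩, hN⟩ := hN
  let f : K' →ₗ[R] N' := eN.toLinearMap ∘ₗ K.subtype ∘ₗ eK.symm.toLinearMap
  let S : ShortComplex (ModuleCat.{u} R) := .mk (ModuleCat.ofHom f)
    (ModuleCat.ofHom (LinearMap.range f).mkQ) (by ext; simp)
  have hS : S.ShortExact :=
    { exact := (ShortComplex.ShortExact.moduleCat_exact_iff_function_exact S).2
        (LinearMap.exact_map_mkQ_range f)
      mono_f := (ModuleCat.mono_iff_injective _).2
        (eN.injective.comp (K.injective_subtype.comp eK.symm.injective))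
      epi_g := (ModuleCat.epi_iff_surjective _).2 (Submodule.mkQ_surjective _) }
  have hf : K.map eN.toLinearMap = LinearMap.range f := by
    rw [LinearMap.range_comp, LinearMap.range_comp_of_range_eq_top _ eK.symm.range,
      K.range_subtype]
  exact ⟨S.X₃, ⟨Submodule.Quotient.equiv _ _ eN hf⟩, fun i hi =>
    subsingleton_ext_of_shortExact hS (hK (i + 1) (Nat.add_lt_add_right hi 1)) (hN i hi)⟩

theorem range_of_exact {f : M →ₗ[R] N} {g : N →ₗ[R] P} (hfg : Function.Exact f g)
    (hf : ExtVanishesBelow J (k + 1) (LinearMap.range f)) (hN : ExtVanishesBelow J k N) :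
    ExtVanishesBelow J k (LinearMap.range g) :=
  (hf.quotient hN).of_linearEquiv <|
    (Submodule.quotEquivOfEq _ _ hfg.linearMap_ker_eq.symm).trans g.quotKerEquivRange

theorem eq_zero_of_forall_smul_eq_zero (h : ExtVanishesBelow J 1 M) {x : M}
    (hx : ∀ a ∈ J, a • x = 0) : x = 0 := by
  obtain ⟨M', ⟨e⟩, hM'⟩ := h
  have := hM' 0 one_pos
  let φ : (R ⧸ J) →ₗ[R] M' := J.liftQ (LinearMap.toSpanSingleton R M' (e x)) fun a ha => by
    rw [LinearMap.mem_ker, LinearMap.toSpanSingleton_apply, ← map_smul, hx a ha, map_zero]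
  have hφ : φ = 0 := ModuleCat.hom_ext_iff.1 <|
    (Ext.mk₀_eq_zero_iff (ModuleCat.ofHom φ)).1 (Subsingleton.elim _ _)
  refine e.map_eq_zero_iff.1 ?_
  calc e x = φ (Submodule.Quotient.mk 1) := (one_smul R (e x)).symm
    _ = 0 := LinearMap.congr_fun hφ _

theorem mem_of_forall_smul_mem {K : Submodule R N} (hK : ExtVanishesBelow J 2 K)
    (hN : ExtVanishesBelow J 1 N) {x : N} (hx : ∀ a ∈ J, a • x ∈ K) : x ∈ K :=
  (Submodule.Quotient.mk_eq_zero K).1 <|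
    (hK.quotient hN).eq_zero_of_forall_smul_eq_zero fun a ha =>
      (Submodule.Quotient.mk_eq_zero K).2 (hx a ha)

end ExtVanishesBelow

variable {F₀ F₁ F₂ F₃ F₄ : Type*} [AddCommGroup F₀] [Module R F₀] [AddCommGroup F₁] [Module R F₁]
  [AddCommGroup F₂] [Module R F₂] [AddCommGroup F₃] [Module R F₃] [AddCommGroup F₄] [Module R F₄]
  [Module.Finite R F₁] [Module.Projective R F₁] [Module.Finite R F₂] [Module.Projective R F₂]
  [Module.Finite R F₃] [Module.Projective R F₃]
  {d₄ : F₄ →ₗ[R] F₃} {d₃ : F₃ →ₗ[R] F₂} {d₂ : F₂ →ₗ[R] F₁} {d₁ : F₁ →ₗ[R] F₀}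

theorem IsAcyclicThree.extVanishesBelow_range (hF : IsAcyclicThree d₃ d₂ d₁)
    (hJ : ((k + 2 : ℕ) : ℕ∞) ≤ idealGrade J) : ExtVanishesBelow J k (LinearMap.range d₁) := by
  have h₃ : ExtVanishesBelow J (k + 2) (LinearMap.range d₃) :=
    (extVanishesBelow_of_le_idealGrade hJ).of_linearEquiv (.ofInjective d₃ hF.1)
  have h₂ : ExtVanishesBelow J (k + 1) (LinearMap.range d₂) := .range_of_exact hF.2.1 h₃ <|
    extVanishesBelow_of_le_idealGrade <| (Nat.cast_le.2 (by lia)).trans hJ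
  exact .range_of_exact hF.2.2 h₂ <|
    extVanishesBelow_of_le_idealGrade <| (Nat.cast_le.2 (by lia)).trans hJ

theorem IsAcyclicFour.extVanishesBelow_range [Module.Finite R F₄] [Module.Projective R F₄]
    (hF : IsAcyclicFour d₄ d₃ d₂ d₁) (hJ : ((k + 3 : ℕ) : ℕ∞) ≤ idealGrade J) :
    ExtVanishesBelow J k (LinearMap.range d₁) := by
  have h₂ : ExtVanishesBelow J (k + 1) (LinearMap.range d₂) :=
    IsAcyclicThree.extVanishesBelow_range ⟨hF.1, hF.2.1, hF.2.2.1⟩ hJ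
  exact .range_of_exact hF.2.2.2 h₂ <|
    extVanishesBelow_of_le_idealGrade <| (Nat.cast_le.2 (by lia)).trans hJ

variable [Module.Finite R F₀] [Module.Projective R F₀] {x : F₀}

theorem IsAcyclicThree.mem_range_of_forall_smul_mem (hF : IsAcyclicThree d₃ d₂ d₁)
    (hJ : 4 ≤ idealGrade J) (hx : ∀ a ∈ J, a • x ∈ LinearMap.range d₁) :
    x ∈ LinearMap.range d₁ :=
  (hF.extVanishesBelow_range hJ).mem_of_forall_smul_mem
    (extVanishesBelow_of_le_idealGrade (le_trans (by norm_num) hJ)) hx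

theorem IsAcyclicFour.mem_range_of_forall_smul_mem [Module.Finite R F₄] [Module.Projective R F₄]
    (hF : IsAcyclicFour d₄ d₃ d₂ d₁) (hJ : 5 ≤ idealGrade J)
    (hx : ∀ a ∈ J, a • x ∈ LinearMap.range d₁) : x ∈ LinearMap.range d₁ :=
  (hF.extVanishesBelow_range hJ).mem_of_forall_smul_mem
    (extVanishesBelow_of_le_idealGrade (le_trans (by norm_num) hJ)) hx

end ExtVanishing

section Construction

variable {R : Type*} [CommRing R] {A₁ A₂ A₃ : Type*}
  [AddCommGroup A₁] [Module R A₁] [AddCommGroup A₂] [Module R A₂]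
  [AddCommGroup A₃] [Module R A₃]
  {d₃ : A₃ →ₗ[R] A₂} {d₂ : A₂ →ₗ[R] A₁} {d₁ : A₁ →ₗ[R] R}

theorem mem_range_of_comp_eq_smul_id [Module.Finite R A₁] [Module.Projective R A₁]
    [Module.Finite R A₂] [Module.Projective R A₂] (h₂₃ : Function.Exact d₃ d₂)
    (hA' : IsAcyclicThree d₁.dualMap d₂.dualMap d₃.dualMap) {y : R} {s : A₂ →ₗ[R] A₃}
    (hs : s ∘ₗ d₃ = y • LinearMap.id) : y ∈ LinearMap.range d₁ := by
  -- `s`, `t`, `w` are the components of a null-homotopy of multiplication by `y` on the complex.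
  obtain ⟨t, ht⟩ : ∃ t : A₁ →ₗ[R] A₂, t ∘ₗ d₂ = y • LinearMap.id - d₃ ∘ₗ s := by
    refine (exact_twistedDual hA'.2.2 _).1 ?_
    change (y • LinearMap.id - d₃ ∘ₗ s) ∘ₗ d₃ = 0
    rw [LinearMap.sub_comp, LinearMap.comp_assoc, hs]
    ext; simp
  obtain ⟨w, hw⟩ : ∃ w : R →ₗ[R] A₁, w ∘ₗ d₁ = y • LinearMap.id - d₂ ∘ₗ t := by
    refine (exact_twistedDual hA'.2.1 _).1 ?_
    change (y • LinearMap.id - d₂ ∘ₗ t) ∘ₗ d₂ = 0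
    rw [LinearMap.sub_comp, LinearMap.comp_assoc, ht, LinearMap.comp_sub, ← LinearMap.comp_assoc,
      h₂₃.linearMap_comp_eq_zero]
    ext; simp
  have h₁₂ : d₁ ∘ₗ d₂ = 0 := hA'.2.1.apply_apply_eq_zero LinearMap.id
  have hdw : d₁ ∘ₗ w = y • LinearMap.id := by
    apply hA'.1
    change (d₁ ∘ₗ w) ∘ₗ d₁ = (y • LinearMap.id) ∘ₗ d₁
    rw [LinearMap.comp_assoc, hw, LinearMap.comp_sub, ← LinearMap.comp_assoc, h₁₂]
    ext; simp
  exact ⟨w 1, by simpa using LinearMap.congr_fun hdw 1⟩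

theorem finite_and_projective_of_isCompl {C L : Submodule R A₃} (hCL : IsCompl C L)
    [Module.Finite R C] [Module.Projective R C] [Module.Finite R L]
    [Module.Projective R L] : Module.Finite R A₃ ∧ Module.Projective R A₃ :=
  ⟨.equiv (C.prodEquivOfIsCompl L hCL), .of_equiv (C.prodEquivOfIsCompl L hCL)⟩

variable {C L : Submodule R A₃} (hCL : IsCompl C L)

theorem etaProj_apply_left (l : L) : etaProj hCL l = l :=
  Submodule.projectionOnto_apply_left hCL.symm l

theorem etaProj_eq_zero_iff {g : A₃} : etaProj hCL g = 0 ↔ g ∈ C :=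
  Submodule.projectionOnto_apply_eq_zero_iff hCL.symm

theorem sub_etaProj_mem (g : A₃) : g - etaProj hCL g ∈ C := by
  rw [← etaProj_eq_zero_iff hCL, map_sub, etaProj_apply_left, sub_self]

theorem exists_eq_smul_etaProj [Module.Invertible R L] {ρ : A₃ →ₗ[R] L} (hρ : ∀ c ∈ C, ρ c = 0) :
    ∃ x : R, ∀ g, ρ g = x • etaProj hCL g := by
  obtain ⟨x, hx⟩ := (Module.Invertible.toModuleEnd_bijective R L).2 (ρ ∘ₗ L.subtype)
  refine ⟨x, fun g => ?_⟩
  calc ρ g = ρ (etaProj hCL g) := by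
        rw [← sub_eq_zero, ← map_sub, hρ _ (sub_etaProj_mem hCL g)]
    _ = x • etaProj hCL g := (LinearMap.congr_fun hx _).symm

theorem smul_mem_range_of_mem_minorsIdeal [Module.Finite R A₁] [Module.Projective R A₁]
    [Module.Finite R A₂] [Module.Projective R A₂] {n : ℕ} (b : Module.Basis (Fin n) R C)
    (h₂₃ : Function.Exact d₃ d₂) (hA' : IsAcyclicThree d₁.dualMap d₂.dualMap d₃.dualMap)
    {x : R} {ψ : A₂ →ₗ[R] L} (hψ : ∀ g, ψ (d₃ g) = x • etaProj hCL g)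
    {a : R} (ha : a ∈ minorsIdeal n (deltaFour d₃ C)) : a • x ∈ LinearMap.range d₁ := by
  obtain ⟨σ, hσ⟩ := exists_comp_eq_smul_id_of_mem_minorsIdeal b ha
  have hσC (g : A₃) : σ (d₃ (g - etaProj hCL g)) = a • (g - etaProj hCL g) :=
    congrArg C.subtype (LinearMap.congr_fun hσ ⟨_, sub_etaProj_mem hCL g⟩)
  -- `x • σ` and `a • ψ` give `a x` on `C` and on `L`, up to the value of `x • σ` on `d₃ L`.
  refine mem_range_of_comp_eq_smul_id h₂₃ hA'
    (s := x • C.subtype ∘ₗ σ + a • L.subtype ∘ₗ ψ - C.subtype ∘ₗ σ ∘ₗ d₃ ∘ₗ L.subtype ∘ₗ ψ)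
    (LinearMap.ext fun g => ?_)
  have hg := hσC g
  simp only [map_sub, Submodule.coe_sub] at hg
  simp only [LinearMap.sub_apply, LinearMap.add_apply, LinearMap.smul_apply,
    LinearMap.comp_apply, hψ, map_smul, Submodule.subtype_apply, LinearMap.id_apply,
    eq_add_of_sub_eq hg]
  module

theorem deltaTwo_apply (μ : DGAStructure d₃ d₂ d₁) (φ : A₁ →ₗ[R] L) (e : A₁) (f : A₂) :
    deltaTwo μ hCL (φ, e) f = etaProj hCL (μ.mul₁₂ e f) + φ (d₂ f) :=
  rfl

variable (μ : DGAStructure d₃ d₂ d₁)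

theorem etaProj_mul_d₃ (hA : IsAcyclicThree d₃ d₂ d₁) (e : A₁) (g : A₃) :
    etaProj hCL (μ.mul₁₂ e (d₃ g)) = d₁ e • etaProj hCL g := by
  rw [← map_smul, sub_eq_zero.1 (μ.leibniz₁₃ hA.1 hA.2.1.apply_apply_eq_zero e g)]

theorem isComplexFour_delta (hA : IsAcyclicThree d₃ d₂ d₁) :
    IsComplexFour (deltaFour d₃ C) (deltaThree μ hCL) (deltaTwo μ hCL) (deltaOne d₃ C L) := by
  have h₂₃ := hA.2.1.apply_apply_eq_zero
  have hC (e : A₁) (c : C) : etaProj hCL (μ.mul₁₂ e (d₃ c)) = 0 := by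
    rw [etaProj_mul_d₃ hCL μ hA, (etaProj_eq_zero_iff hCL).2 c.2, smul_zero]
  refine ⟨LinearMap.ext fun c => Prod.ext (LinearMap.ext fun e => hC e c) (h₂₃ c),
    LinearMap.ext fun f => LinearMap.ext fun f' => ?_,
    LinearMap.ext fun ⟨φ, e⟩ => LinearMap.ext fun c => ?_⟩
  · change etaProj hCL (μ.mul₁₂ (d₂ f) f') + etaProj hCL (μ.mul₁₂ (d₂ f') f) = 0
    rw [← map_add, μ.leibniz₂₂ hA.1 hA.2.2.apply_apply_eq_zero, map_zero]
  · change etaProj hCL (μ.mul₁₂ e (d₃ c)) + φ (d₂ (d₃ c)) = 0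
    rw [hC, h₂₃, map_zero, add_zero]

theorem isSelfDualFour_delta [Module.Finite R A₁] [Module.Projective R A₁]
    [Module.Finite R A₂] [Module.Projective R A₂] [Module.Finite R C] [Module.Projective R C]
    [Module.Invertible R L] :
    IsSelfDualFour (hyperbolicPairing R A₁ L)
      (deltaFour d₃ C) (deltaThree μ hCL) (deltaTwo μ hCL) (deltaOne d₃ C L) :=
  ⟨bijective_applyₗ, bijective_applyₗ, bijective_hyperbolicPairing bijective_applyₗ, rfl,
    LinearMap.ext fun _ => LinearMap.ext fun _ => add_comm _ _, rfl, rfl⟩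

theorem exact_deltaFour_deltaThree [Module.Projective R L] (hA : IsAcyclicThree d₃ d₂ d₁)
    (h₁ : Function.Injective d₁.dualMap) :
    Function.Exact (deltaFour d₃ C) (deltaThree μ hCL) := by
  refine fun f => ⟨fun hf => ?_, ?_⟩
  · obtain ⟨g, rfl⟩ := (hA.2.1 f).1 (congrArg Prod.snd hf)
    have hg : LinearMap.toSpanSingleton R L (etaProj hCL g) = 0 := by
      refine (map_eq_zero_iff _ (injective_twistedDual h₁)).1 (LinearMap.ext fun e => ?_)
      exact (etaProj_mul_d₃ hCL μ hA e g).symm.trans (LinearMap.congr_fun (congrArg Prod.fst hf) e)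
    exact ⟨⟨g, (etaProj_eq_zero_iff hCL).1 ((LinearMap.toSpanSingleton_eq_zero_iff R L).1 hg)⟩, rfl⟩
  · rintro ⟨c, rfl⟩
    exact LinearMap.congr_fun (isComplexFour_delta hCL μ hA).1 c

theorem d₁_eq_zero_of_deltaTwo_eq_zero [FaithfulSMul R L] (hA : IsAcyclicThree d₃ d₂ d₁)
    {φ : A₁ →ₗ[R] L} {e : A₁} (h : deltaTwo μ hCL (φ, e) = 0) : d₁ e = 0 := by
  refine FaithfulSMul.eq_of_smul_eq_smul (α := L) fun l => ?_
  calc d₁ e • l = deltaTwo μ hCL (φ, e) (d₃ l) := by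
        rw [deltaTwo_apply, etaProj_mul_d₃ hCL μ hA, hA.2.1.apply_apply_eq_zero,
          etaProj_apply_left, map_zero, add_zero]
    _ = (0 : R) • l := by rw [h, LinearMap.zero_apply, zero_smul]

theorem exact_deltaThree_deltaTwo [Module.Finite R L] [Module.Projective R L] [FaithfulSMul R L]
    (hA : IsAcyclicThree d₃ d₂ d₁) (h₁₂ : Function.Exact d₁.dualMap d₂.dualMap) :
    Function.Exact (deltaThree μ hCL) (deltaTwo μ hCL) := by
  have hcomplex := (isComplexFour_delta hCL μ hA).2.1
  rintro ⟨φ, e⟩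
  refine ⟨fun h => ?_, ?_⟩
  · obtain ⟨f, rfl⟩ := (hA.2.2 e).1 (d₁_eq_zero_of_deltaTwo_eq_zero hCL μ hA h)
    -- `δ₃ f` has the right second component; correct its first one by an element of `d₃ L`.
    have hφ : twistedDual L d₂ (φ - (deltaThree μ hCL f).1) = 0 := by
      refine LinearMap.ext fun f' => ?_
      have hff' : etaProj hCL (μ.mul₁₂ (d₂ f) f') + φ (d₂ f') =
          etaProj hCL (μ.mul₁₂ (d₂ f) f') + (deltaThree μ hCL f).1 (d₂ f') :=
        LinearMap.congr_fun (h.trans (LinearMap.congr_fun hcomplex f).symm) f'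
      exact sub_eq_zero.2 (add_left_cancel hff')
    obtain ⟨w, hw⟩ := (exact_twistedDual h₁₂ _).1 hφ
    refine ⟨f + d₃ (w 1), Prod.ext (LinearMap.ext fun e => ?_) ?_⟩
    · have hwe : d₁ e • w 1 = φ e - etaProj hCL (μ.mul₁₂ e f) := by
        rw [← map_smul, smul_eq_mul, mul_one]
        exact LinearMap.congr_fun hw e
      change etaProj hCL (μ.mul₁₂ e (f + d₃ (w 1))) = φ e
      rw [map_add, map_add, etaProj_mul_d₃ hCL μ hA, etaProj_apply_left, hwe,
        add_sub_cancel]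
    · exact (map_add d₂ _ _).trans (by rw [hA.2.1.apply_apply_eq_zero, add_zero])
  · rintro ⟨f, hf⟩
    rw [← hf]
    exact LinearMap.congr_fun hcomplex f

end Construction

section Acyclicity

variable {R : Type u} [CommRing R] {A₁ A₂ A₃ : Type*}
  [AddCommGroup A₁] [Module R A₁] [AddCommGroup A₂] [Module R A₂]
  [AddCommGroup A₃] [Module R A₃]
  [Module.Finite R A₁] [Module.Projective R A₁] [Module.Finite R A₂] [Module.Projective R A₂]
  {d₃ : A₃ →ₗ[R] A₂} {d₂ : A₂ →ₗ[R] A₁} {d₁ : A₁ →ₗ[R] R}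
  {C L : Submodule R A₃} (hCL : IsCompl C L) [Module.Invertible R L]
  (μ : DGAStructure d₃ d₂ d₁)

theorem exact_deltaTwo_deltaOne [Module.Finite R A₃] [Module.Projective R A₃]
    (hA : IsAcyclicThree d₃ d₂ d₁) (hA' : IsAcyclicThree d₁.dualMap d₂.dualMap d₃.dualMap)
    {n : ℕ} (b : Module.Basis (Fin n) R C)
    (hJ : 4 ≤ idealGrade (minorsIdeal n (deltaFour d₃ C))) :
    Function.Exact (deltaTwo μ hCL) (deltaOne d₃ C L) := by
  refine fun ψ => ⟨fun hψ => ?_, ?_⟩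
  · obtain ⟨x, hx⟩ := exists_eq_smul_etaProj hCL (ρ := ψ ∘ₗ d₃) fun c hc =>
      LinearMap.congr_fun hψ ⟨c, hc⟩
    obtain ⟨e, rfl⟩ := hA.mem_range_of_forall_smul_mem hJ fun a ha =>
      smul_mem_range_of_mem_minorsIdeal hCL b hA.2.1 hA' hx ha
    obtain ⟨φ, hφ⟩ : ψ - etaProj hCL ∘ₗ μ.mul₁₂ e ∈ LinearMap.range (twistedDual L d₂) := by
      refine (exact_twistedDual hA'.2.2 _).1 (LinearMap.ext fun g => sub_eq_zero.2 ?_)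
      exact (hx g).trans (etaProj_mul_d₃ hCL μ hA e g).symm
    refine ⟨(φ, e), LinearMap.ext fun f => ?_⟩
    exact (add_comm _ _).trans (eq_sub_iff_add_eq.1 (LinearMap.congr_fun hφ f))
  · rintro ⟨y, rfl⟩
    exact LinearMap.congr_fun (isComplexFour_delta hCL μ hA).2.2 y

theorem isAcyclicFour_delta (hA : IsAcyclicThree d₃ d₂ d₁)
    (hA' : IsAcyclicThree d₁.dualMap d₂.dualMap d₃.dualMap)
    {n : ℕ} (hC : IsFreeOfRank R C n)
    (hJ : 4 ≤ idealGrade (minorsIdeal n (deltaFour d₃ C))) :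
    IsAcyclicFour (deltaFour d₃ C) (deltaThree μ hCL) (deltaTwo μ hCL) (deltaOne d₃ C L) := by
  obtain ⟨_, _⟩ := hC.finite_and_projective
  obtain ⟨_, _⟩ := finite_and_projective_of_isCompl hCL
  obtain ⟨b⟩ := hC
  exact ⟨hA.1.comp C.injective_subtype, exact_deltaFour_deltaThree hCL μ hA hA'.1,
    exact_deltaThree_deltaTwo hCL μ hA hA'.2.1, exact_deltaTwo_deltaOne hCL μ hA hA' b hJ⟩

theorem minorsIdeal_eq_top_of_isAcyclicFour {n : ℕ} (hC : IsFreeOfRank R C n)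
    (hB : IsAcyclicFour (deltaFour d₃ C) (deltaThree μ hCL) (deltaTwo μ hCL) (deltaOne d₃ C L))
    (hJ : 5 ≤ idealGrade (minorsIdeal n (deltaFour d₃ C))) :
    minorsIdeal n (deltaFour d₃ C) = ⊤ := by
  obtain ⟨_, _⟩ := hC.finite_and_projective
  obtain ⟨b⟩ := hC
  have := finite_linearMap (R := R) (M := A₁) (Q := L)
  have := projective_linearMap (R := R) (M := A₁) (Q := L)
  have := finite_linearMap (R := R) (M := A₂) (Q := L)
  have := projective_linearMap (R := R) (M := A₂) (Q := L)
  have := finite_linearMap (R := R) (M := C) (Q := L)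
  have := projective_linearMap (R := R) (M := C) (Q := L)
  -- The maximal minors of `δ₄` kill the cokernel of `δ₁`.
  have hδ₁ : Function.Surjective (deltaOne d₃ C L) := fun χ =>
    hB.mem_range_of_forall_smul_mem hJ fun a ha => smul_mem_range_twistedDual b ha χ
  exact minorsIdeal_eq_top_of_surjective_dualMap b
    (surjective_dualMap_of_surjective_twistedDual hδ₁)

end Acyclicity

theorem mainTheorem1_general {R : Type u} [CommRing R] {A₁ A₂ A₃ : Type*}
    [AddCommGroup A₁] [Module R A₁] [Module.Finite R A₁] [Module.Projective R A₁]
    [AddCommGroup A₂] [Module R A₂] [Module.Finite R A₂] [Module.Projective R A₂]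
    [AddCommGroup A₃] [Module R A₃]
    {d₃ : A₃ →ₗ[R] A₂} {d₂ : A₂ →ₗ[R] A₁} {d₁ : A₁ →ₗ[R] R}
    (hA : IsAcyclicThree d₃ d₂ d₁)
    (hA' : IsAcyclicThree d₁.dualMap d₂.dualMap d₃.dualMap)
    (μ : DGAStructure d₃ d₂ d₁)
    {C L : Submodule R A₃} (hCL : IsCompl C L) [Module.Invertible R L]
    {n : ℕ} (hC : IsFreeOfRank R C n) :
    IsComplexFour (deltaFour d₃ C) (deltaThree μ hCL) (deltaTwo μ hCL) (deltaOne d₃ C L) ∧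
    IsSelfDualFour (hyperbolicPairing R A₁ L)
      (deltaFour d₃ C) (deltaThree μ hCL) (deltaTwo μ hCL) (deltaOne d₃ C L) ∧
    (4 ≤ idealGrade (minorsIdeal n (deltaFour d₃ C)) →
      IsAcyclicFour (deltaFour d₃ C) (deltaThree μ hCL) (deltaTwo μ hCL) (deltaOne d₃ C L) ∧
      (idealGrade (minorsIdeal n (deltaFour d₃ C)) = 4 ∨
        minorsIdeal n (deltaFour d₃ C) = ⊤)) := by
  obtain ⟨_, _⟩ := hC.finite_and_projective
  refine ⟨isComplexFour_delta hCL μ hA, isSelfDualFour_delta hCL μ, fun hJ => ?_⟩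
  have hB := isAcyclicFour_delta hCL μ hA hA' hC hJ
  refine ⟨hB, hJ.eq_or_lt.imp Eq.symm fun h => minorsIdeal_eq_top_of_isAcyclicFour hCL μ hC hB ?_⟩
  exact le_of_eq_of_le (by norm_num) (Order.add_one_le_of_lt h)

theorem mainTheorem1 {R : Type u} [CommRing R] [IsNoetherianRing R]
    (p q : ℕ) (hp : 1 ≤ p) (hq : 3 ≤ q)
    {A₁ A₂ A₃ : Type v}
    [AddCommGroup A₁] [Module R A₁] [AddCommGroup A₂] [Module R A₂]
    [AddCommGroup A₃] [Module R A₃]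
    (hA₁ : IsFreeOfRank R A₁ (p + 2)) (hA₂ : IsFreeOfRank R A₂ (p + q))
    (hA₃ : IsFreeOfRank R A₃ (q - 1))
    (d₃ : A₃ →ₗ[R] A₂) (d₂ : A₂ →ₗ[R] A₁) (d₁ : A₁ →ₗ[R] R)
    (hA : IsAcyclicThree d₃ d₂ d₁)
    (hA' : IsAcyclicThree d₁.dualMap d₂.dualMap d₃.dualMap)
    (μ : DGAStructure d₃ d₂ d₁)
    (C L : Submodule R A₃) (hCL : IsCompl C L)
    (hC : IsFreeOfRank R C (q - 2)) (hL : IsFreeOfRank R L 1) :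
    IsComplexFour (deltaFour d₃ C) (deltaThree μ hCL) (deltaTwo μ hCL) (deltaOne d₃ C L) ∧
    IsSelfDualFour (hyperbolicPairing R A₁ L)
      (deltaFour d₃ C) (deltaThree μ hCL) (deltaTwo μ hCL) (deltaOne d₃ C L) ∧
    (4 ≤ idealGrade (minorsIdeal (q - 2) (deltaFour d₃ C)) →
      IsAcyclicFour (deltaFour d₃ C) (deltaThree μ hCL) (deltaTwo μ hCL) (deltaOne d₃ C L) ∧
      (idealGrade (minorsIdeal (q - 2) (deltaFour d₃ C)) = 4 ∨
        minorsIdeal (q - 2) (deltaFour d₃ C) = ⊤)) := by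
  obtain ⟨_, _⟩ := hA₁.finite_and_projective
  obtain ⟨_, _⟩ := hA₂.finite_and_projective
  have := hL.invertible
  exact mainTheorem1_general hA hA' μ hCL hC
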